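/- For $d \ge 2$ and $n \ge 0$ let $h_{3,d}(n)$ be the largest integer $m$ such that every set of $n$ distinct points in $\mathbb{R}^d$, no three of them collinear, contains a subset $X$ of $m$ points for which the areas of the triangles spanned by the different three-element subsets of $X$ are pairwise different. Then, as $n \to \infty$, 1. $h_{3,2}(n) \ge \Omega\big((\log\log n)^{1/186}\big)$; 2. $h_{3,3}(n) \ge \Omega\big((\log\log n)^{1/396}\big)$. That is, there are constants $c > 0$ and $N$ such that for all $n \ge N$, $h_{3,2}(n) \ge c\,(\log\log n)^{1/186}$ and $h_{3,3}(n) \ge c\,(\log\log n)^{1/396}$. -/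

import Mathlib

/-- Area of the triangle with vertices `p`, `q`, `r` in `ℝ^d`: half the area
`√(‖u‖² ‖v‖² - ⟪u, v⟫²)` of the parallelogram spanned by `u = q - p` and `v = r - p`. -/
noncomputable def triArea {d : ℕ} (p q r : EuclideanSpace ℝ (Fin d)) : ℝ :=
  Real.sqrt (‖q - p‖ ^ 2 * ‖r - p‖ ^ 2 - (inner ℝ (q - p) (r - p)) ^ 2) / 2

/-- `triArea` is the elementary area: half of the product of two sides and the sine of the
enclosed angle. -/
theorem triArea_eq_sin {d : ℕ} (p q r : EuclideanSpace ℝ (Fin d)) :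
    triArea p q r = dist p q * dist p r * Real.sin (EuclideanGeometry.angle q p r) / 2 := by
  have h := InnerProductGeometry.sin_angle_mul_norm_mul_norm (q - p) (r - p)
  rw [real_inner_self_eq_norm_sq, real_inner_self_eq_norm_sq, ← pow_two] at h
  rw [triArea, ← h, dist_comm p q, dist_comm p r, dist_eq_norm, dist_eq_norm,
    EuclideanGeometry.angle, vsub_eq_sub, vsub_eq_sub]
  ring

/-- No three distinct points of `P` lie on a line. -/
def NoThreeCollinear {d : ℕ} (P : Finset (EuclideanSpace ℝ (Fin d))) : Prop :=
  ∀ p ∈ P, ∀ q ∈ P, ∀ r ∈ P, p ≠ q → p ≠ r → q ≠ r → ¬ Collinear ℝ {p, q, r}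

/-- Different three-element subsets of `X` span triangles of different areas. -/
def DistinctAreas {d : ℕ} (X : Finset (EuclideanSpace ℝ (Fin d))) : Prop :=
  ∀ p ∈ X, ∀ q ∈ X, ∀ r ∈ X, p ≠ q → p ≠ r → q ≠ r →
  ∀ p' ∈ X, ∀ q' ∈ X, ∀ r' ∈ X, p' ≠ q' → p' ≠ r' → q' ≠ r' →
    triArea p q r = triArea p' q' r' →
      ({p, q, r} : Set (EuclideanSpace ℝ (Fin d))) = {p', q', r'}

/-- The sizes `m` such that every set of `n` points in `ℝ^d`, no three collinear, has a subset
of `m` points all of whose triangle areas are distinct. -/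
def guaranteedSizes (d n : ℕ) : Set ℕ :=
  {m | ∀ P : Finset (EuclideanSpace ℝ (Fin d)), P.card = n → NoThreeCollinear P →
    ∃ X ⊆ P, X.card = m ∧ DistinctAreas X}

/-- `h_{3,d}(n)`: the largest guaranteed size. -/
noncomputable def h3 (d n : ℕ) : ℕ := sSup (guaranteedSizes d n)

/-- In dimension at least two there are `n` points with no three collinear, for every `n`. -/
theorem exists_noThreeCollinear (d n : ℕ) (hd : 2 ≤ d) :
    ∃ P : Finset (EuclideanSpace ℝ (Fin d)), P.card = n ∧ NoThreeCollinear P := by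
  classical
  let i0 : Fin d := ⟨0, by omega⟩
  let i1 : Fin d := ⟨1, by omega⟩
  have h10 : i1 ≠ i0 := by simp [i0, i1]
  let f : ℕ → EuclideanSpace ℝ (Fin d) := fun k =>
    WithLp.toLp 2 (fun i => if i = i0 then (k : ℝ) else (k : ℝ) ^ 2)
  have f0 : ∀ k, f k i0 = k := fun k => by simp [f]
  have f1 : ∀ k, f k i1 = (k : ℝ) ^ 2 := fun k => by simp [f, h10]
  have hf : Function.Injective f := fun a b hab => by
    have := f0 a
    rw [hab, f0] at this
    exact Nat.cast_injective (R := ℝ) this.symm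
  refine ⟨(Finset.range n).image f, by simp [Finset.card_image_of_injective _ hf], ?_⟩
  intro p hp q hq r hr hpq hpr hqr hc
  simp only [Finset.mem_image] at hp hq hr
  obtain ⟨a, -, rfl⟩ := hp
  obtain ⟨b, -, rfl⟩ := hq
  obtain ⟨c, -, rfl⟩ := hr
  rw [collinear_iff_of_mem (p₀ := f a) (by simp)] at hc
  obtain ⟨v, hv⟩ := hc
  obtain ⟨s, hs⟩ := hv (f b) (by simp)
  obtain ⟨t, ht⟩ := hv (f c) (by simp)
  have s0 := congrArg (fun x => x i0) hs
  have s1 := congrArg (fun x => x i1) hs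
  have t0 := congrArg (fun x => x i0) ht
  have t1 := congrArg (fun x => x i1) ht
  simp only [vadd_eq_add, PiLp.add_apply, PiLp.smul_apply, smul_eq_mul, f0, f1] at s0 s1 t0 t1
  have hab : (b : ℝ) - a ≠ 0 := fun h => hpq (by
    rw [show a = b by exact_mod_cast (sub_eq_zero.mp h).symm])
  have hac : (c : ℝ) - a ≠ 0 := fun h => hpr (by
    rw [show a = c by exact_mod_cast (sub_eq_zero.mp h).symm])
  have hbc : (c : ℝ) - b ≠ 0 := fun h => hqr (by
    rw [show b = c by exact_mod_cast (sub_eq_zero.mp h).symm])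
  have : ((b : ℝ) - a) * (c - a) * (c - b) = 0 := by
    have e1 : (b : ℝ) - a = s * v i0 := by linarith
    have e2 : (b : ℝ) ^ 2 - a ^ 2 = s * v i1 := by linarith
    have e3 : (c : ℝ) - a = t * v i0 := by linarith
    have e4 : (c : ℝ) ^ 2 - a ^ 2 = t * v i1 := by linarith
    calc ((b : ℝ) - a) * (c - a) * (c - b)
        = (b - a) * (c ^ 2 - a ^ 2) - (c - a) * (b ^ 2 - a ^ 2) := by ring
      _ = 0 := by rw [e1, e2, e3, e4]; ring
  exact (mul_ne_zero (mul_ne_zero hab hac) hbc) this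

/-- In dimension at least two the supremum defining `h3` is a maximum. -/
theorem isGreatest_h3 (d n : ℕ) (hd : 2 ≤ d) : IsGreatest (guaranteedSizes d n) (h3 d n) := by
  obtain ⟨P, hP, hP'⟩ := exists_noThreeCollinear d n hd
  have hb : BddAbove (guaranteedSizes d n) := ⟨n, fun m hm => by
    obtain ⟨X, hX, hm', -⟩ := hm P hP hP'
    rw [← hm', ← hP]
    exact Finset.card_le_card hX⟩
  have h0 : 0 ∈ guaranteedSizes d n := fun Q _ _ =>
    ⟨∅, by simp, by simp, by simp [DistinctAreas]⟩
  exact ⟨Nat.sSup_mem ⟨0, h0⟩ hb, fun m hm => le_csSup hb hm⟩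

open Filter

/-! For fixed `x`, `y`, four times the squared area of the triangle `x y z` is a polynomial of
degree at most two in `z`. If `X` is a largest subset of `P` with distinct areas, each further point
of `P` creates a coincidence of areas, so it lies on one of polynomially many (in `|X|`) quadrics
(`exists_covering_of_not_distinctAreas`). Since no three points are collinear, these quadrics can be
chosen not to contain `P`.

By pigeonhole one quadric holds a large share of `P`. Restricting to it enlarges the space of
quadratic functions vanishing on the set, which can happen at most `D` times, `D` being the
dimension of all quadratic functions (`exists_subset_of_covering`). Hence the guaranteed size grows
at least like `n ^ (1 / (5 * D))`, far above any power of `log log n`. -/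

/-! ### Pigeonhole and dimension descent -/

/-- The functions in `V` that vanish on `P`. -/
def vanishingOn {E : Type*} (V : Submodule ℝ (E → ℝ)) (P : Finset E) : Submodule ℝ (E → ℝ) where
  carrier := {f | f ∈ V ∧ ∀ z ∈ P, f z = 0}
  zero_mem' := ⟨V.zero_mem, fun _ _ => rfl⟩
  add_mem' := fun ha hb => ⟨V.add_mem ha.1 hb.1, fun z hz => by simp [ha.2 z hz, hb.2 z hz]⟩
  smul_mem' := fun c _ ha => ⟨V.smul_mem c ha.1, fun z hz => by simp [ha.2 z hz]⟩

/-- If every subset `P'` of `P` without property `S` is covered, up to `m` exceptional points, by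
the zero sets of at most `N` functions of the finite-dimensional space `V`, none of which vanishes
on all of `P'`, then a large `P` contains a subset with property `S`. -/
theorem exists_subset_of_covering {E : Type*} (V : Submodule ℝ (E → ℝ)) [FiniteDimensional ℝ V]
    (h1 : (fun _ => 1) ∈ V) (S : Finset E → Prop) (m N : ℕ) (k : ℕ) (P : Finset E)
    (hS : ∀ P' ⊆ P, ¬ S P' → ∃ X : Finset E, X.card ≤ m ∧ ∃ G : Finset (E → ℝ), G.card ≤ N ∧
      (∀ g ∈ G, g ∈ V ∧ ∃ z ∈ P', g z ≠ 0) ∧ ∀ z ∈ P', z ∉ X → ∃ g ∈ G, g z = 0)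
    (hk : Module.finrank ℝ V ≤ k + Module.finrank ℝ (vanishingOn V P))
    (hP : (m + N + 1) ^ k ≤ P.card) : ∃ P' ⊆ P, S P' := by
  classical
  have hle : ∀ Q, vanishingOn V Q ≤ V := fun Q f hf => hf.1
  have hfin : ∀ Q, FiniteDimensional ℝ (vanishingOn V Q) := fun Q =>
    Submodule.finiteDimensional_of_le (hle Q)
  induction k generalizing P with
  | zero =>
    rw [pow_zero] at hP
    obtain ⟨z, hz⟩ := Finset.card_pos.mp hP
    -- No codimension is left, so even the constant `1` would vanish on the nonempty set `P`.
    have he : vanishingOn V P = V := Submodule.eq_of_le_of_finrank_le (hle P) (by omega)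
    have := (he.symm ▸ h1 : (fun _ => 1) ∈ vanishingOn V P).2 z hz
    norm_num at this
  | succ k ih =>
    by_cases hSP : S P
    · exact ⟨P, subset_rfl, hSP⟩
    obtain ⟨X, hX, G, hG, hGV, hcov⟩ := hS P subset_rfl hSP
    -- Otherwise `P` would have at most `m + N * (m + N + 1) ^ k` points, fewer than `(m + N + 1) ^
    -- (k + 1)`.
    have hbig : ∃ g ∈ G, (m + N + 1) ^ k ≤ (P.filter (fun z => g z = 0)).card := by
      by_contra! hcon
      have hsub : P ⊆ X ∪ G.biUnion (fun g => P.filter (fun z => g z = 0)) := by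
        intro z hz
        by_cases hzX : z ∈ X
        · exact Finset.mem_union_left _ hzX
        · obtain ⟨g, hg, hgz⟩ := hcov z hz hzX
          exact Finset.mem_union_right _
            (Finset.mem_biUnion.mpr ⟨g, hg, Finset.mem_filter.mpr ⟨hz, hgz⟩⟩)
      have hb : (G.biUnion (fun g => P.filter (fun z => g z = 0))).card
          ≤ G.card * (m + N + 1) ^ k :=
        Finset.card_biUnion_le_card_mul _ _ _ (fun g hg => (hcon g hg).le)
      have hc := (Finset.card_le_card hsub).trans (Finset.card_union_le _ _)
      have hpos : 1 ≤ (m + N + 1) ^ k := Nat.one_le_pow _ _ (by omega)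
      have hN : G.card * (m + N + 1) ^ k ≤ N * (m + N + 1) ^ k := Nat.mul_le_mul_right _ hG
      have hm : m ≤ m * (m + N + 1) ^ k := Nat.le_mul_of_pos_right _ hpos
      have he : (m + N + 1) ^ (k + 1)
          = m * (m + N + 1) ^ k + N * (m + N + 1) ^ k + (m + N + 1) ^ k := by ring
      omega
    obtain ⟨g, hg, hgc⟩ := hbig
    have hsub : P.filter (fun z => g z = 0) ⊆ P := Finset.filter_subset _ _
    have hlt : vanishingOn V P < vanishingOn V (P.filter (fun z => g z = 0)) := by
      refine lt_of_le_of_ne (fun f hf => ⟨hf.1, fun z hz => hf.2 z (hsub hz)⟩) fun heq => ?_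
      have hgm : g ∈ vanishingOn V (P.filter (fun z => g z = 0)) :=
        ⟨(hGV g hg).1, fun z hz => (Finset.mem_filter.mp hz).2⟩
      rw [← heq] at hgm
      obtain ⟨z, hz, hgz⟩ := (hGV g hg).2
      exact hgz (hgm.2 z hz)
    have := Submodule.finrank_lt_finrank_of_lt hlt
    obtain ⟨P', hP', hSP'⟩ := ih _ (fun P' hP' => hS P' (hP'.trans hsub)) (by omega) hgc
    exact ⟨P', hP'.trans hsub, hSP'⟩

/-! ### Squared areas as Gram determinants -/

variable {d : ℕ}

/-- The Gram determinant of `q - p` and `r - p`: four times the squared area. -/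
noncomputable def gramArea (p q r : EuclideanSpace ℝ (Fin d)) : ℝ :=
  ‖q - p‖ ^ 2 * ‖r - p‖ ^ 2 - (inner ℝ (q - p) (r - p)) ^ 2

theorem gramArea_nonneg (p q r : EuclideanSpace ℝ (Fin d)) : 0 ≤ gramArea p q r := by
  have h := abs_real_inner_le_norm (q - p) (r - p)
  rw [gramArea, ← mul_pow, sub_nonneg]
  exact sq_le_sq' (abs_le.mp h).1 (abs_le.mp h).2

theorem triArea_eq_iff_gramArea_eq (p q r p' q' r' : EuclideanSpace ℝ (Fin d)) :
    triArea p q r = triArea p' q' r' ↔ gramArea p q r = gramArea p' q' r' := by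
  have h : ∀ a b c : EuclideanSpace ℝ (Fin d), triArea a b c = Real.sqrt (gramArea a b c) / 2 :=
    fun _ _ _ => rfl
  rw [h, h, div_left_inj' two_ne_zero, Real.sqrt_inj (gramArea_nonneg _ _ _) (gramArea_nonneg _ _ _)]

theorem gramArea_swap_right (p q r : EuclideanSpace ℝ (Fin d)) :
    gramArea p q r = gramArea p r q := by
  rw [gramArea, gramArea, real_inner_comm]
  ring

theorem gramArea_swap_left (p q r : EuclideanSpace ℝ (Fin d)) :
    gramArea p q r = gramArea q p r := by
  have h1 : p - q = -(q - p) := by abel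
  have h2 : r - q = (r - p) - (q - p) := by abel
  rw [gramArea, gramArea, h1, h2, norm_neg, norm_sub_sq_real (r - p) (q - p), inner_neg_left,
    inner_sub_right (q - p) (r - p) (q - p), real_inner_self_eq_norm_sq,
    real_inner_comm (q - p) (r - p)]
  ring

@[simp] theorem gramArea_self_right (p q : EuclideanSpace ℝ (Fin d)) : gramArea p q q = 0 := by
  rw [gramArea, real_inner_self_eq_norm_sq]
  ring

@[simp] theorem gramArea_self_outer (p q : EuclideanSpace ℝ (Fin d)) : gramArea p q p = 0 := by
  simp [gramArea]

theorem collinear_of_gramArea_eq_zero {p q r : EuclideanSpace ℝ (Fin d)}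
    (h : gramArea p q r = 0) : Collinear ℝ {p, q, r} := by
  have ht : triArea p q r = 0 := by
    change Real.sqrt (gramArea p q r) / 2 = 0
    simp [h]
  rw [triArea_eq_sin] at ht
  have h' : Collinear ℝ {q, p, r} := by
    rw [EuclideanGeometry.collinear_iff_eq_or_eq_or_sin_eq_zero]
    have : dist p q * dist p r * Real.sin (EuclideanGeometry.angle q p r) = 0 := by linarith
    rcases mul_eq_zero.mp this with h | h
    · rcases mul_eq_zero.mp h with h | h
      · exact Or.inl (dist_eq_zero.mp h).symm
      · exact Or.inr (Or.inl (dist_eq_zero.mp h).symm)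
    · exact Or.inr (Or.inr h)
  rwa [Set.insert_comm] at h'

theorem NoThreeCollinear.gramArea_ne_zero {P : Finset (EuclideanSpace ℝ (Fin d))}
    (hP : NoThreeCollinear P) {p q r : EuclideanSpace ℝ (Fin d)} (hp : p ∈ P) (hq : q ∈ P)
    (hr : r ∈ P) (hpq : p ≠ q) (hpr : p ≠ r) (hqr : q ≠ r) : gramArea p q r ≠ 0 :=
  fun h => hP p hp q hq r hr hpq hpr hqr (collinear_of_gramArea_eq_zero h)

/-! ### Quadratic functions -/

/-- The constant `1` and the coordinate functions. -/
def affineMonomial (i : Option (Fin d)) (z : EuclideanSpace ℝ (Fin d)) : ℝ :=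
  i.elim 1 (fun j => z j)

/-- The functions on `ℝ^d` given by polynomials of degree at most two. -/
def quadraticFunctions (d : ℕ) : Submodule ℝ (EuclideanSpace ℝ (Fin d) → ℝ) :=
  Submodule.span ℝ (Set.range fun ij : Option (Fin d) × Option (Fin d) =>
    fun z => affineMonomial ij.1 z * affineMonomial ij.2 z)

instance : FiniteDimensional ℝ (quadraticFunctions d) :=
  FiniteDimensional.span_of_finite ℝ (Set.finite_range _)

theorem affineMonomial_mul_mem (i j : Option (Fin d)) :
    (fun z => affineMonomial i z * affineMonomial j z) ∈ quadraticFunctions d :=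
  Submodule.subset_span ⟨(i, j), rfl⟩

theorem const_mem_quadraticFunctions (c : ℝ) : (fun _ => c) ∈ quadraticFunctions d := by
  have := (quadraticFunctions d).smul_mem c (affineMonomial_mul_mem none none)
  convert this using 1
  ext z
  simp [affineMonomial]

theorem sub_mul_sub_mem (p : EuclideanSpace ℝ (Fin d)) (i j : Fin d) :
    (fun z : EuclideanSpace ℝ (Fin d) => (z i - p i) * (z j - p j)) ∈ quadraticFunctions d := by
  have hij := affineMonomial_mul_mem (some i) (some j)
  have hi := (quadraticFunctions d).smul_mem (p j) (affineMonomial_mul_mem (some i) none)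
  have hj := (quadraticFunctions d).smul_mem (p i) (affineMonomial_mul_mem none (some j))
  have hc := const_mem_quadraticFunctions (d := d) (p i * p j)
  convert (quadraticFunctions d).add_mem
    ((quadraticFunctions d).sub_mem ((quadraticFunctions d).sub_mem hij hi) hj) hc using 1
  ext z
  simp [affineMonomial]
  ring

theorem gramArea_mem_quadraticFunctions (p q : EuclideanSpace ℝ (Fin d)) :
    gramArea p q ∈ quadraticFunctions d := by
  have h1 := (quadraticFunctions d).smul_mem (‖q - p‖ ^ 2)
    ((quadraticFunctions d).sum_mem (t := Finset.univ) fun i _ => sub_mul_sub_mem p i i)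
  have h2 := (quadraticFunctions d).sum_mem (t := Finset.univ) fun i _ =>
    (quadraticFunctions d).sum_mem (t := Finset.univ) fun j _ =>
      (quadraticFunctions d).smul_mem ((q i - p i) * (q j - p j)) (sub_mul_sub_mem p i j)
  convert (quadraticFunctions d).sub_mem h1 h2 using 1
  ext z
  have e1 : ‖z - p‖ ^ 2 = ∑ i, (z i - p i) * (z i - p i) := by
    rw [EuclideanSpace.real_norm_sq_eq]
    simp [pow_two]
  have e2 : (inner ℝ (q - p) (z - p)) ^ 2
      = ∑ i, ∑ j, (q i - p i) * (q j - p j) * ((z i - p i) * (z j - p j)) := by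
    rw [PiLp.inner_apply, pow_two, Finset.sum_mul_sum]
    refine Finset.sum_congr rfl fun i _ => Finset.sum_congr rfl fun j _ => ?_
    simp
    ring
  rw [gramArea, e1, e2]
  simp [Finset.sum_apply]

/-! ### Adding a point to a set with distinct areas -/

theorem exists_pair_of_mem_insert [DecidableEq (EuclideanSpace ℝ (Fin d))]
    {X : Finset (EuclideanSpace ℝ (Fin d))} {z p q r : EuclideanSpace ℝ (Fin d)}
    (hp : p ∈ insert z X) (hq : q ∈ insert z X) (hr : r ∈ insert z X)
    (hpq : p ≠ q) (hpr : p ≠ r) (hqr : q ≠ r) :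
    (p ∈ X ∧ q ∈ X ∧ r ∈ X) ∨ ∃ x ∈ X, ∃ y ∈ X, x ≠ y ∧
      ({p, q, r} : Set (EuclideanSpace ℝ (Fin d))) = {x, y, z} ∧
      gramArea p q r = gramArea x y z := by
  rw [Finset.mem_insert] at hp hq hr
  rcases hp with rfl | hp
  · have hq' := hq.resolve_left hpq.symm
    have hr' := hr.resolve_left hpr.symm
    refine Or.inr ⟨q, hq', r, hr', hqr, ?_, ?_⟩
    · ext; simp; tauto
    · rw [gramArea_swap_left, gramArea_swap_right]
  rcases hq with rfl | hq
  · have hr' := hr.resolve_left hqr.symm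
    refine Or.inr ⟨p, hp, r, hr', hpr, ?_, ?_⟩
    · ext; simp; tauto
    · rw [gramArea_swap_right]
  rcases hr with rfl | hr
  · exact Or.inr ⟨p, hp, q, hq, hpq, rfl, rfl⟩
  · exact Or.inl ⟨hp, hq, hr⟩

/-- Only triangles with vertex `z` are new: `h1` compares them with old triangles, `h2` with each
other. -/
theorem DistinctAreas.insert [DecidableEq (EuclideanSpace ℝ (Fin d))]
    {X : Finset (EuclideanSpace ℝ (Fin d))} (hX : DistinctAreas X)
    {z : EuclideanSpace ℝ (Fin d)}
    (h1 : ∀ x ∈ X, ∀ y ∈ X, ∀ a ∈ X, ∀ b ∈ X, ∀ c ∈ X, x ≠ y → a ≠ b → a ≠ c → b ≠ c →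
      gramArea x y z ≠ gramArea a b c)
    (h2 : ∀ x ∈ X, ∀ y ∈ X, ∀ a ∈ X, ∀ b ∈ X, x ≠ y → a ≠ b →
      gramArea x y z = gramArea a b z →
        ({x, y} : Set (EuclideanSpace ℝ (Fin d))) = {a, b}) :
    DistinctAreas (insert z X) := by
  intro p hp q hq r hr hpq hpr hqr p' hp' q' hq' r' hr' hpq' hpr' hqr' h
  rw [triArea_eq_iff_gramArea_eq] at h
  rcases exists_pair_of_mem_insert hp hq hr hpq hpr hqr with
    ⟨a, b, c⟩ | ⟨x, hx, y, hy, hxy, hs, hA⟩ <;>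
  rcases exists_pair_of_mem_insert hp' hq' hr' hpq' hpr' hqr' with
    ⟨a', b', c'⟩ | ⟨x', hx', y', hy', hxy', hs', hA'⟩
  · exact hX p a q b r c hpq hpr hqr p' a' q' b' r' c' hpq' hpr' hqr'
      ((triArea_eq_iff_gramArea_eq _ _ _ _ _ _).mpr h)
  · exact absurd (hA'.symm.trans h.symm) (h1 _ hx' _ hy' _ a _ b _ c hxy' hpq hpr hqr)
  · exact absurd (hA.symm.trans h) (h1 _ hx _ hy _ a' _ b' _ c' hxy hpq' hpr' hqr')
  · have := h2 _ hx _ hy _ hx' _ hy' hxy hxy' (hA.symm.trans (h.trans hA'))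
    rw [hs, hs']
    ext w
    have hw := Set.ext_iff.mp this w
    simp only [Set.mem_insert_iff, Set.mem_singleton_iff] at hw ⊢
    tauto

/-- A set without large subsets of distinct areas is covered, up to a few points, by the zero sets
of few quadratic functions, none of which vanishes on the whole set. -/
theorem exists_covering_of_not_distinctAreas {P : Finset (EuclideanSpace ℝ (Fin d))}
    (hP : NoThreeCollinear P) {m : ℕ} (hm : ¬ ∃ X ⊆ P, m ≤ X.card ∧ DistinctAreas X) :
    ∃ X : Finset (EuclideanSpace ℝ (Fin d)), X.card ≤ m ∧
      ∃ G : Finset (EuclideanSpace ℝ (Fin d) → ℝ), G.card ≤ m ^ 5 + m ^ 4 ∧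
        (∀ g ∈ G, g ∈ quadraticFunctions d ∧ ∃ z ∈ P, g z ≠ 0) ∧
        ∀ z ∈ P, z ∉ X → ∃ g ∈ G, g z = 0 := by
  classical
  obtain ⟨X, hXm, hXmax⟩ := (P.powerset.filter DistinctAreas).exists_max_image Finset.card
    ⟨∅, by simp [DistinctAreas]⟩
  rw [Finset.mem_filter, Finset.mem_powerset] at hXm
  obtain ⟨hXP, hX⟩ := hXm
  have hXc : X.card ≤ m := by
    by_contra! h
    exact hm ⟨X, hXP, h.le, hX⟩
  let G1 : Finset (EuclideanSpace ℝ (Fin d) → ℝ) := (X ×ˢ X ×ˢ X ×ˢ X ×ˢ X).image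
    fun t => gramArea t.1 t.2.1 - fun _ => gramArea t.2.2.1 t.2.2.2.1 t.2.2.2.2
  let G2 : Finset (EuclideanSpace ℝ (Fin d) → ℝ) := (X ×ˢ X ×ˢ X ×ˢ X).image
    fun t => gramArea t.1 t.2.1 - gramArea t.2.2.1 t.2.2.2
  have hG1 : G1.card ≤ m ^ 5 := by
    refine Finset.card_image_le.trans ?_
    simp only [Finset.card_product]
    calc _ = X.card ^ 5 := by ring
      _ ≤ m ^ 5 := Nat.pow_le_pow_left hXc 5
  have hG2 : G2.card ≤ m ^ 4 := by
    refine Finset.card_image_le.trans ?_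
    simp only [Finset.card_product]
    calc _ = X.card ^ 4 := by ring
      _ ≤ m ^ 4 := Nat.pow_le_pow_left hXc 4
  refine ⟨X, hXc, (G1 ∪ G2).filter (fun g => ∃ z ∈ P, g z ≠ 0), ?_, ?_, ?_⟩
  · exact (Finset.card_filter_le _ _).trans ((Finset.card_union_le _ _).trans (by omega))
  · intro g hg
    rw [Finset.mem_filter, Finset.mem_union] at hg
    refine ⟨?_, hg.2⟩
    rcases hg.1 with h | h
    · obtain ⟨t, -, rfl⟩ := Finset.mem_image.mp h
      exact Submodule.sub_mem _ (gramArea_mem_quadraticFunctions _ _)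
        (const_mem_quadraticFunctions _)
    · obtain ⟨t, -, rfl⟩ := Finset.mem_image.mp h
      exact Submodule.sub_mem _ (gramArea_mem_quadraticFunctions _ _)
        (gramArea_mem_quadraticFunctions _ _)
  · intro z hz hzX
    by_contra! hcon
    have hins : DistinctAreas (insert z X) := by
      refine hX.insert ?_ ?_
      · intro x hx y hy a ha b hb c hc _ hab hac hbc heq
        -- At `z = x` this function equals `-gramArea a b c`, which is nonzero.
        refine hcon (gramArea x y - fun _ => gramArea a b c)
          (Finset.mem_filter.mpr ⟨Finset.mem_union_left _ (Finset.mem_image.mpr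
            ⟨(x, y, a, b, c), by simp [hx, hy, ha, hb, hc], rfl⟩), x, hXP hx, ?_⟩)
          (sub_eq_zero.mpr heq)
        have := hP.gramArea_ne_zero (hXP ha) (hXP hb) (hXP hc) hab hac hbc
        simpa using this
      · intro x hx y hy a ha b hb hxy hab heq
        have hne : ∀ w ∈ P, w ≠ a → w ≠ b → gramArea a b w ≠ 0 := fun w hw hwa hwb =>
          hP.gramArea_ne_zero (hXP ha) (hXP hb) hw hab hwa.symm hwb.symm
        -- If the difference vanishes on all of `P`, it gives no usable quadric. But then `x` and
        -- `y` are zeros of `gramArea a b`, whose only zeros in `P` are `a` and `b`.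
        have hvan : ∀ w ∈ P, gramArea x y w = gramArea a b w := by
          by_contra! hw
          obtain ⟨w, hw, hne⟩ := hw
          exact hcon (gramArea x y - gramArea a b)
            (Finset.mem_filter.mpr ⟨Finset.mem_union_right _ (Finset.mem_image.mpr
              ⟨(x, y, a, b), by simp [hx, hy, ha, hb], rfl⟩), w, hw, sub_ne_zero.mpr hne⟩)
            (sub_eq_zero.mpr heq)
        have hx' : x = a ∨ x = b := by
          by_contra! h
          exact hne x (hXP hx) h.1 h.2 (by rw [← hvan x (hXP hx), gramArea_self_outer])
        have hy' : y = a ∨ y = b := by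
          by_contra! h
          exact hne y (hXP hy) h.1 h.2 (by rw [← hvan y (hXP hy), gramArea_self_right])
        rcases hx' with rfl | rfl <;> rcases hy' with rfl | rfl
        · exact absurd rfl hxy
        · rfl
        · exact Set.pair_comm _ _
        · exact absurd rfl hxy
    have hmax := hXmax (insert z X) (Finset.mem_filter.mpr
      ⟨Finset.mem_powerset.mpr (Finset.insert_subset hz hXP), hins⟩)
    rw [Finset.card_insert_of_notMem hzX] at hmax
    omega

/-! ### Polynomial growth and the final bounds -/

theorem NoThreeCollinear.mono {P Q : Finset (EuclideanSpace ℝ (Fin d))}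
    (hQ : NoThreeCollinear Q) (h : P ⊆ Q) : NoThreeCollinear P :=
  fun p hp q hq r hr => hQ p (h hp) q (h hq) r (h hr)

theorem DistinctAreas.mono {X Y : Finset (EuclideanSpace ℝ (Fin d))}
    (hY : DistinctAreas Y) (h : X ⊆ Y) : DistinctAreas X :=
  fun p hp q hq r hr h1 h2 h3 p' hp' q' hq' r' hr' =>
    hY p (h hp) q (h hq) r (h hr) h1 h2 h3 p' (h hp') q' (h hq') r' (h hr')

/-- `h3 d n` grows at least like a power of `n`. -/
theorem le_h3_of_pow_le (hd : 2 ≤ d) {m n : ℕ}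
    (h : (m + (m ^ 5 + m ^ 4) + 1) ^ Module.finrank ℝ (quadraticFunctions d) ≤ n) :
    m ≤ h3 d n := by
  refine (isGreatest_h3 d n hd).2 fun P hPn hP => ?_
  -- With `k` the full dimension, the rank hypothesis is automatic.
  obtain ⟨P', hP', X, hX, hmX, hXd⟩ := exists_subset_of_covering (quadraticFunctions d)
    (const_mem_quadraticFunctions 1) (fun P' => ∃ X ⊆ P', m ≤ X.card ∧ DistinctAreas X)
    m (m ^ 5 + m ^ 4) (Module.finrank ℝ (quadraticFunctions d)) P
    (fun P' hP' hS => exists_covering_of_not_distinctAreas (hP.mono hP') hS)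
    (Nat.le_add_right _ _) (h.trans hPn.ge)
  obtain ⟨Y, hYX, hY⟩ := Finset.exists_subset_card_eq hmX
  exact ⟨Y, hYX.trans (hX.trans hP'), hY, hXd.mono hYX⟩

theorem exists_loglog_rpow_le_h3 (hd : 2 ≤ d) {s : ℝ} (hs0 : 0 < s) (hs1 : s ≤ 1) :
    ∃ c : ℝ, 0 < c ∧ ∃ N : ℕ, ∀ n : ℕ, N ≤ n →
      c * (Real.log (Real.log (n : ℝ))) ^ s ≤ (h3 d n : ℝ) := by
  set D := Module.finrank ℝ (quadraticFunctions d)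
  have hlog : Tendsto (fun n : ℕ => Real.log (n : ℝ)) atTop atTop :=
    Real.tendsto_log_atTop.comp tendsto_natCast_atTop_atTop
  have hLL : Tendsto (fun n : ℕ => Real.log (Real.log (n : ℝ))) atTop atTop :=
    Real.tendsto_log_atTop.comp hlog
  have hexp : ∀ᶠ x : ℝ in atTop, 4 ^ D * x ^ (5 * D) ≤ Real.exp x := by
    have h := (Real.isLittleO_pow_exp_atTop (n := 5 * D)).bound
      (show (0 : ℝ) < (4 ^ D)⁻¹ by positivity)
    filter_upwards [h, eventually_ge_atTop 0] with x hx hx0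
    rw [Real.norm_of_nonneg (by positivity), Real.norm_of_nonneg (by positivity),
      inv_mul_eq_div, le_div_iff₀ (by positivity)] at hx
    linarith
  -- The constant `1 / 2` absorbs the floor: `L ^ s < m + 1 ≤ 2 * m` once `m ≥ 1`.
  refine ⟨1 / 2, by norm_num, eventually_atTop.mp ?_⟩
  filter_upwards [hLL.eventually_ge_atTop 1, hLL.eventually hexp, hlog.eventually_gt_atTop 0,
    eventually_gt_atTop 0] with n hL hE hl hn
  set L := Real.log (Real.log (n : ℝ))
  have hLs1 : 1 ≤ L ^ s := Real.one_le_rpow hL hs0.le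
  have hLs : L ^ s ≤ L := by
    simpa using Real.rpow_le_rpow_of_exponent_le hL hs1
  set m := ⌊L ^ s⌋₊
  have hm1 : 1 ≤ m := Nat.one_le_floor_iff _ |>.mpr hLs1
  have hmL : (m : ℝ) ≤ L := (Nat.floor_le (by linarith)).trans hLs
  have hlt : L ^ s < m + 1 := Nat.lt_floor_add_one _
  have hm1' : (1 : ℝ) ≤ m := by exact_mod_cast hm1
  have hmh : m ≤ h3 d n := by
    refine le_h3_of_pow_le hd ?_
    have hb : m + (m ^ 5 + m ^ 4) + 1 ≤ 4 * m ^ 5 := by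
      have h1 := Nat.pow_le_pow_right hm1 (show 1 ≤ 5 by norm_num)
      have h4 := Nat.pow_le_pow_right hm1 (show 4 ≤ 5 by norm_num)
      have h0 := Nat.one_le_pow 5 m hm1
      rw [pow_one] at h1
      omega
    refine (Nat.pow_le_pow_left hb D).trans ?_
    have hnr : ((4 * m ^ 5) ^ D : ℝ) ≤ n := by
      calc ((4 * m ^ 5) ^ D : ℝ) = 4 ^ D * (m : ℝ) ^ (5 * D) := by rw [mul_pow, ← pow_mul]
        _ ≤ 4 ^ D * L ^ (5 * D) := by gcongr
        _ ≤ Real.exp L := hE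
        _ = Real.log n := Real.exp_log hl
        _ ≤ n := Real.log_le_self (Nat.cast_nonneg n)
    exact_mod_cast hnr
  have : (m : ℝ) ≤ h3 d n := by exact_mod_cast hmh
  linarith

theorem mainTheorem2 :
    (∃ c : ℝ, 0 < c ∧ ∃ N : ℕ, ∀ n : ℕ, N ≤ n →
      c * (Real.log (Real.log (n : ℝ))) ^ ((1 : ℝ) / 186) ≤ (h3 2 n : ℝ)) ∧
    (∃ c : ℝ, 0 < c ∧ ∃ N : ℕ, ∀ n : ℕ, N ≤ n →
      c * (Real.log (Real.log (n : ℝ))) ^ ((1 : ℝ) / 396) ≤ (h3 3 n : ℝ)) :=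
  ⟨exists_loglog_rpow_le_h3 le_rfl (by norm_num) (by norm_num),
    exists_loglog_rpow_le_h3 (by norm_num) (by norm_num) (by norm_num)⟩
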